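/- Let $I_1=\{m+ni : m\in\mathbb Z,\ m\ge 1,\ n\in\mathbb Z\}\subset\mathbb C$, let $D=\{z\in\mathbb C : |z-\tfrac12|\le\tfrac12\}$, and let $C_{\mathbb R}(D)$ be the real Banach space of continuous functions $D\to\mathbb R$ with the sup norm. Let $\mathcal B\subset I_1$ be nonempty and set $$\sigma(\mathcal B)=\inf\Big\{s>0 : \exists z\in D \text{ with } \sum_{b\in\mathcal B}\frac1{|z+b|^{2s}}<\infty\Big\}.$$ For every $s>\sigma(\mathcal B)$ the formula $$(L_sf)(z)=\sum_{b\in\mathcal B}\frac{1}{|z+b|^{2s}}\,f\Big(\frac1{z+b}\Big),\qquad z\in D,$$ defines a bounded linear operator $L_s:C_{\mathbb R}(D)\to C_{\mathbb R}(D)$, and the following holds. There is a strictly positive Lipschitz function $v_s:D\to\mathbb R$ with $L_sv_s=\lambda_sv_s$, where $\lambda_s>0$ and $\lambda_s=r(L_s)=\lim_{k\to\infty}\|L_s^k\|^{1/k}$. It is unique up to scalar multiples: every strictly positive $w\in C_{\mathbb R}(D)$ with $L_sw=\mu w$ for some $\mu\in\mathbb R$ is a scalar multiple of $v_s$. If $\mathcal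 B$ is closed under complex conjugation, then $v_s(\bar z)=v_s(z)$ for all $z\in D$. If $\mathcal B$ is finite, then $v_s$ is $C^\infty$ on $D$ (as a function of the two real variables $x,y$ with $z=x+iy$, up to the boundary), and $x\mapsto v_s(x+iy)$ is strictly decreasing for each fixed $y$: if $x_1<x_2$ and $x_1+iy,\ x_2+iy\in D$, then $v_s(x_2+iy)<v_s(x_1+iy)$. -/

import Mathlib

open Topology Filter

open scoped ContDiff

noncomputable section

namespace ComplexCF

/-- The index set `{m + n i : m ∈ ℤ, m ≥ 1, n ∈ ℤ}`. -/
def indexSet : Set ℂ :=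
  {b | ∃ m n : ℤ, 1 ≤ m ∧ b = (m : ℂ) + (n : ℂ) * Complex.I}

/-- The closed disc `D` with centre `1/2` and radius `1/2` in the complex plane. -/
abbrev disc : Set ℂ := Metric.closedBall (1 / 2 : ℂ) (1 / 2)

/-- The infimum of all `s > 0` for which `∑_{b ∈ B} 1 / |z + b|^{2s}` converges
for some `z` in the disc. -/
def criticalExponent (B : Set ℂ) : ℝ :=
  sInf {s : ℝ | 0 < s ∧ ∃ z ∈ disc, Summable fun b : B => 1 / ‖z + (b : ℂ)‖ ^ (2 * s)}

theorem mem_disc_iff (z : ℂ) : z ∈ disc ↔ z.re ^ 2 + z.im ^ 2 ≤ z.re := by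
  rw [Metric.mem_closedBall, dist_eq_norm, ← abs_of_nonneg (norm_nonneg (z - 1 / 2)),
    ← abs_of_pos (show (0 : ℝ) < 1 / 2 by norm_num), ← sq_le_sq, ← Complex.normSq_eq_norm_sq,
    Complex.normSq_apply]
  simp only [Complex.sub_re, Complex.sub_im]
  norm_num
  constructor <;> intro h <;> nlinarith

theorem one_le_re_add {z b : ℂ} (hz : z ∈ disc) (hb : b ∈ indexSet) : 1 ≤ (z + b).re := by
  obtain ⟨m, n, hm, rfl⟩ := hb
  have h := (mem_disc_iff z).1 hz
  have h1 : (1 : ℝ) ≤ m := by exact_mod_cast hm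
  simp
  nlinarith [sq_nonneg z.re, sq_nonneg z.im]

theorem one_le_norm_add {z b : ℂ} (hz : z ∈ disc) (hb : b ∈ indexSet) : 1 ≤ ‖z + b‖ :=
  (one_le_re_add hz hb).trans (Complex.re_le_norm _)

theorem add_ne_zero_of_mem {z b : ℂ} (hz : z ∈ disc) (hb : b ∈ indexSet) : z + b ≠ 0 :=
  norm_pos_iff.1 (zero_lt_one.trans_le (one_le_norm_add hz hb))

theorem inv_mem_disc {w : ℂ} (hw : 1 ≤ w.re) : 1 / w ∈ disc := by
  have hp : 0 < Complex.normSq w := by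
    rw [Complex.normSq_apply]; nlinarith [sq_nonneg w.im]
  have hn : Complex.normSq w = w.re * w.re + w.im * w.im := Complex.normSq_apply w
  rw [mem_disc_iff, one_div, Complex.inv_re, Complex.inv_im]
  have h : (w.re / Complex.normSq w) ^ 2 + (-w.im / Complex.normSq w) ^ 2
      = 1 / Complex.normSq w := by
    field_simp
    rw [hn]; ring
  rw [h]
  gcongr

/-- The map `θ_b(z) = 1 / (z + b)` of the disc into itself. -/
def theta (b : ℂ) (hb : b ∈ indexSet) : C(disc, disc) where
  toFun z := ⟨1 / ((z : ℂ) + b), inv_mem_disc (one_le_re_add z.2 hb)⟩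
  continuous_toFun := by
    refine Continuous.subtype_mk ?_ _
    exact continuous_const.div (by fun_prop) fun z => add_ne_zero_of_mem z.2 hb

theorem norm_add_le_two_mul {z w b : ℂ} (hz : z ∈ disc) (hw : w ∈ disc) (hb : b ∈ indexSet) :
    ‖w + b‖ ≤ 2 * ‖z + b‖ := by
  have h1 : ‖w - z‖ ≤ 1 := by
    rw [← dist_eq_norm]
    refine (dist_triangle_right w z (1 / 2)).trans ?_
    have := Metric.mem_closedBall.1 hz
    have := Metric.mem_closedBall.1 hw
    linarith
  have h2 := one_le_norm_add hz hb
  have h3 : ‖w + b‖ ≤ ‖w - z‖ + ‖z + b‖ := by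
    calc ‖w + b‖ = ‖(w - z) + (z + b)‖ := by ring_nf
      _ ≤ _ := norm_add_le _ _
  linarith

theorem weight_le {z w b : ℂ} {s t : ℝ} (hz : z ∈ disc) (hw : w ∈ disc) (hb : b ∈ indexSet)
    (ht : 0 < t) (hts : t ≤ s) :
    1 / ‖z + b‖ ^ (2 * s) ≤ 2 ^ (2 * t) * (1 / ‖w + b‖ ^ (2 * t)) := by
  have h1 := one_le_norm_add hz hb
  have h2 : 0 < ‖w + b‖ := zero_lt_one.trans_le (one_le_norm_add hw hb)
  have h3 : ‖z + b‖ ^ (2 * t) ≤ ‖z + b‖ ^ (2 * s) :=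
    Real.rpow_le_rpow_of_exponent_le h1 (by linarith)
  have h4 : ‖w + b‖ ^ (2 * t) ≤ 2 ^ (2 * t) * ‖z + b‖ ^ (2 * t) := by
    rw [← Real.mul_rpow (by norm_num) (norm_nonneg _)]
    exact Real.rpow_le_rpow h2.le (norm_add_le_two_mul hz hw hb) (by linarith)
  have h5 : 0 < ‖w + b‖ ^ (2 * t) := Real.rpow_pos_of_pos h2 _
  have h6 : 0 < ‖z + b‖ ^ (2 * s) := Real.rpow_pos_of_pos (by linarith) _
  have h7 : (0 : ℝ) < 2 ^ (2 * t) := by positivity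
  rw [mul_one_div, div_le_div_iff₀ h6 h5, one_mul]
  exact h4.trans (by gcongr)

/-- The series converges for every exponent `s > 1`, so the infimum that defines
`criticalExponent B` is taken over a nonempty set. -/
theorem summable_of_one_lt {B : Set ℂ} (hB : B ⊆ indexSet) {s : ℝ} (hs : 1 < s) :
    Summable fun b : B => 1 / ‖(0 : ℂ) + (b : ℂ)‖ ^ (2 * s) := by
  have key := EisensteinSeries.summable_one_div_norm_rpow (k := 2 * s) (by linarith)
  have hex : ∀ b : B, ∃ x : Fin 2 → ℤ, 1 ≤ x 0 ∧
      (b : ℂ) = (x 0 : ℂ) + (x 1 : ℂ) * Complex.I := fun b => by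
    obtain ⟨m, n, hm, h⟩ := hB b.2
    exact ⟨![m, n], by simpa using hm, by simpa using h⟩
  choose x hx0 hx using hex
  have hinj : Function.Injective x := fun a b hab => Subtype.ext (by rw [hx a, hx b, hab])
  refine Summable.of_nonneg_of_le (fun b => by positivity) (fun b => ?_)
    (key.comp_injective hinj)
  have hpos : 0 < ‖x b‖ := by
    rw [norm_pos_iff]
    intro h
    have := hx0 b
    simp [h] at this
  have hle : ‖x b‖ ≤ ‖(0 : ℂ) + (b : ℂ)‖ := by
    rw [zero_add, pi_norm_le_iff_of_nonneg (norm_nonneg _)]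
    intro i
    fin_cases i
    · have h := Complex.abs_re_le_norm (b : ℂ)
      rw [hx b] at h ⊢
      simpa [Int.norm_eq_abs] using h
    · have h := Complex.abs_im_le_norm (b : ℂ)
      rw [hx b] at h ⊢
      simpa [Int.norm_eq_abs] using h
  simp only [Function.comp_apply]
  rw [Real.rpow_neg hpos.le, ← one_div]
  exact one_div_le_one_div_of_le (Real.rpow_pos_of_pos hpos _)
    (Real.rpow_le_rpow hpos.le hle (by linarith))

/-- For `s > criticalExponent B` the weights are dominated on the whole disc by a summable
family. -/
theorem exists_bound {B : Set ℂ} (hB : B ⊆ indexSet) {s : ℝ} (hs : criticalExponent B < s) :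
    ∃ u : B → ℝ, Summable u ∧ ∀ z ∈ disc, ∀ b : B, 1 / ‖z + (b : ℂ)‖ ^ (2 * s) ≤ u b := by
  have hne : {s : ℝ | 0 < s ∧ ∃ z ∈ disc,
      Summable fun b : B => 1 / ‖z + (b : ℂ)‖ ^ (2 * s)}.Nonempty :=
    ⟨2, by norm_num, 0, by rw [mem_disc_iff]; simp, summable_of_one_lt hB (by norm_num)⟩
  obtain ⟨t, ⟨ht, w, hw, hsum⟩, hts⟩ := exists_lt_of_csInf_lt hne hs
  exact ⟨_, hsum.mul_left (2 ^ (2 * t)), fun z hz b => weight_le hz hw (hB b.2) ht hts.le⟩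

theorem summable_weight {B : Set ℂ} (hB : B ⊆ indexSet) {s : ℝ} (hs : criticalExponent B < s)
    (z : disc) : Summable fun b : B => 1 / ‖(z : ℂ) + (b : ℂ)‖ ^ (2 * s) := by
  obtain ⟨u, hu, h⟩ := exists_bound hB hs
  exact Summable.of_nonneg_of_le (fun b => by positivity) (h z z.2) hu

theorem norm_term_le {B : Set ℂ} (hB : B ⊆ indexSet) {s : ℝ} (f : C(disc, ℝ)) {u : B → ℝ}
    (hu : ∀ z ∈ disc, ∀ b : B, 1 / ‖z + (b : ℂ)‖ ^ (2 * s) ≤ u b) (b : B) (z : disc) :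
    ‖1 / ‖(z : ℂ) + (b : ℂ)‖ ^ (2 * s) * f (theta b (hB b.2) z)‖ ≤ u b * ‖f‖ := by
  rw [norm_mul, Real.norm_of_nonneg (by positivity)]
  gcongr
  · exact (show (0 : ℝ) ≤ _ by positivity).trans (hu z z.2 b)
  · exact hu z z.2 b
  · exact f.norm_coe_le_norm _

/-- The bounded linear operator `L_s` on the real Banach space `C(D)` with the sup norm,
`(L_s f)(z) = ∑_{b ∈ B} |z + b|^{-2s} f(1 / (z + b))`, for `s > criticalExponent B`. -/
def transferOp (B : Set ℂ) (hB : B ⊆ indexSet) (s : ℝ) (hs : criticalExponent B < s) :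
    C(disc, ℝ) →L[ℝ] C(disc, ℝ) :=
  LinearMap.mkContinuousOfExistsBound
    { toFun := fun f =>
        { toFun := fun z =>
            ∑' b : B, 1 / ‖(z : ℂ) + (b : ℂ)‖ ^ (2 * s) * f (theta b (hB b.2) z)
          continuous_toFun := by
            obtain ⟨u, hu, h⟩ := exists_bound hB hs
            refine continuous_tsum (fun b => ?_) (hu.mul_right ‖f‖) (norm_term_le hB f h)
            refine Continuous.mul ?_ (by fun_prop)
            have hc : Continuous fun z : disc => ‖(z : ℂ) + (b : ℂ)‖ := by fun_prop
            have hp : ∀ z : disc, 0 < ‖(z : ℂ) + (b : ℂ)‖ := fun z =>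
              zero_lt_one.trans_le (one_le_norm_add z.2 (hB b.2))
            exact continuous_const.div (hc.rpow_const fun z => Or.inl (hp z).ne')
              fun z => (Real.rpow_pos_of_pos (hp z) _).ne' }
      map_add' := fun f g => by
        obtain ⟨u, hu, h⟩ := exists_bound hB hs
        ext z
        have hf := Summable.of_norm_bounded (hu.mul_right ‖f‖) fun b => norm_term_le hB f h b z
        have hg := Summable.of_norm_bounded (hu.mul_right ‖g‖) fun b => norm_term_le hB g h b z
        simp only [ContinuousMap.coe_mk, ContinuousMap.add_apply, mul_add]
        exact hf.tsum_add hg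
      map_smul' := fun c f => by
        ext z
        simp only [ContinuousMap.coe_mk, ContinuousMap.smul_apply, smul_eq_mul, RingHom.id_apply]
        rw [← tsum_mul_left]
        exact tsum_congr fun b => by ring }
    (by
      obtain ⟨u, hu, h⟩ := exists_bound hB hs
      have hz0 : (0 : ℂ) ∈ disc := by rw [mem_disc_iff]; simp
      have hu0 : ∀ b, 0 ≤ u b := fun b =>
        (show (0 : ℝ) ≤ _ by positivity).trans (h 0 hz0 b)
      refine ⟨∑' b, u b, fun f => ?_⟩
      rw [ContinuousMap.norm_le _ (mul_nonneg (tsum_nonneg hu0) (norm_nonneg _))]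
      intro z
      have := tsum_of_norm_bounded (hu.mul_right ‖f‖).hasSum fun b => norm_term_le hB f h b z
      rwa [tsum_mul_right] at this)

theorem transferOp_apply (B : Set ℂ) (hB : B ⊆ indexSet) (s : ℝ) (hs : criticalExponent B < s)
    (f : C(disc, ℝ)) (z : disc) :
    transferOp B hB s hs f z =
      ∑' b : B, 1 / ‖(z : ℂ) + (b : ℂ)‖ ^ (2 * s) * f (theta b (hB b.2) z) := rfl

end ComplexCF

end

open ComplexCF

noncomputable section

namespace ComplexCF

open scoped NNReal

/-! Everything takes place in a closed convex cone generated by the kernels `k_β(z) = |z +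
β|^{-2s}`, `1 ≤ re β`. Since `(z + b) (1 / (z + b) + β) = β (z + b + 1 / β)`, each term of `L_s`
sends `k_β` to `|β|^{-2s} k_{b + 1/β}`, so the cone is invariant once the parameter set `T` is
stable under `β ↦ b + 1 / β` (`transferOp_mem_kernelCone`). Closed conditions linear in `f` need
only be checked on kernels (`kernelCone_inequality`). This gives a Harnack inequality, a Lipschitz
bound and, for bounded `T`, strict decay in the real direction.

Existence (`exists_eigenfunction`): by Arzelà–Ascoli the unit vectors of the cone form a compact
set. The Neumann series `F` of a kernel `u` satisfies `L F = μ (F - u)` and its norm blows up as `μ`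
decreases to the infimum `r` of convergence; normalised solutions then accumulate at an
eigenfunction for `r`. Harnack makes it strictly positive, and comparison with it yields the growth
of `‖L^k‖`.

Uniqueness (`eigenfunction_unique`): the sets where `w / v` attains its minimum and its maximum are
closed and invariant under a map `θ_b` that strictly decreases distances, so they meet. Conjugation
symmetry follows.

Smoothness: for finite `B` the set `T` may be taken compact. Every cone element is then a continuous
functional on `C(T)` applied to `z ↦ (β ↦ k_β(z))`, which is a smooth `C(T)`-valued map. -/

theorem re_nonneg_of_mem_disc {z : ℂ} (hz : z ∈ disc) : 0 ≤ z.re := by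
  nlinarith [(mem_disc_iff z).1 hz, sq_nonneg z.re, sq_nonneg z.im]

theorem zero_mem_disc : (0 : ℂ) ∈ disc := by rw [mem_disc_iff]; simp

theorem one_le_norm_add_of_one_le_re {z β : ℂ} (hz : z ∈ disc) (hβ : 1 ≤ β.re) :
    1 ≤ ‖z + β‖ := by
  refine le_trans ?_ (Complex.re_le_norm _)
  have := re_nonneg_of_mem_disc hz
  rw [Complex.add_re]; linarith

theorem norm_sub_le_one {z w : ℂ} (hz : z ∈ disc) (hw : w ∈ disc) : ‖w - z‖ ≤ 1 := by
  rw [← dist_eq_norm]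
  refine (dist_triangle_right w z (1 / 2)).trans ?_
  have := Metric.mem_closedBall.1 hz
  have := Metric.mem_closedBall.1 hw
  linarith

theorem one_le_re_of_mem_indexSet {b : ℂ} (hb : b ∈ indexSet) : 1 ≤ b.re := by
  simpa using one_le_re_add zero_mem_disc hb

/-! ### The kernel cone and the linear inequalities valid on it. -/

/-- The functions `z ↦ 1 / |z + β|^{2s}` on the disc, for `β ∈ T` with `1 ≤ re β`. -/
def kernelSet (s : ℝ) (T : Set ℂ) : Set C(disc, ℝ) :=
  {f | ∃ β ∈ T, 1 ≤ β.re ∧ ∀ z, f z = 1 / ‖(z : ℂ) + β‖ ^ (2 * s)}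

/-- The closed convex cone generated by the kernels. -/
def kernelCone (s : ℝ) (T : Set ℂ) : Submodule ℝ≥0 C(disc, ℝ) :=
  (Submodule.span ℝ≥0 (kernelSet s T)).topologicalClosure

theorem isClosed_kernelCone (s : ℝ) (T : Set ℂ) : IsClosed (kernelCone s T : Set C(disc, ℝ)) :=
  Submodule.isClosed_topologicalClosure _

theorem kernelSet_subset_kernelCone (s : ℝ) (T : Set ℂ) :
    kernelSet s T ⊆ kernelCone s T :=
  Submodule.subset_span.trans (Submodule.le_topologicalClosure _)

theorem kernelCone_le {s : ℝ} {T : Set ℂ} {P : Submodule ℝ≥0 C(disc, ℝ)}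
    (hP : IsClosed (P : Set C(disc, ℝ))) (h : kernelSet s T ⊆ P) : kernelCone s T ≤ P :=
  Submodule.topologicalClosure_minimal _ (Submodule.span_le.2 h) hP

theorem exists_kernel (s : ℝ) {β : ℂ} (hβ : 1 ≤ β.re) :
    ∃ f : C(disc, ℝ), ∀ z, f z = 1 / ‖(z : ℂ) + β‖ ^ (2 * s) := by
  refine ⟨⟨fun z => 1 / ‖(z : ℂ) + β‖ ^ (2 * s), ?_⟩, fun z => rfl⟩
  have hc : Continuous fun z : disc => ‖(z : ℂ) + β‖ := by fun_prop
  have hp : ∀ z : disc, 0 < ‖(z : ℂ) + β‖ := fun z =>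
    zero_lt_one.trans_le (one_le_norm_add_of_one_le_re z.2 hβ)
  exact continuous_const.div (hc.rpow_const fun z => Or.inl (hp z).ne')
    fun z => (Real.rpow_pos_of_pos (hp z) _).ne'

/-- A continuous functional that is nonnegative on the kernels is nonnegative on the cone. -/
theorem kernelCone_inequality {s : ℝ} {T : Set ℂ} (Λ : C(disc, ℝ) →L[ℝ] ℝ)
    (h : ∀ f ∈ kernelSet s T, 0 ≤ Λ f) {f : C(disc, ℝ)} (hf : f ∈ kernelCone s T) : 0 ≤ Λ f := by
  let P : Submodule ℝ≥0 C(disc, ℝ) :=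
    { carrier := {f | 0 ≤ Λ f}
      add_mem' := fun {a b} ha hb => by
        simp only [Set.mem_ofPred_eq, map_add] at *; positivity
      zero_mem' := by simp
      smul_mem' := fun c a ha => by
        simp only [Set.mem_ofPred_eq, NNReal.smul_def, map_smul, smul_eq_mul] at *
        exact mul_nonneg c.2 ha }
  exact kernelCone_le (P := P) (isClosed_le continuous_const Λ.continuous) h hf

/-- Evaluation at a point of the disc. -/
abbrev evalAt (z : disc) : C(disc, ℝ) →L[ℝ] ℝ := ContinuousMap.evalCLM ℝ z

theorem nonneg_of_mem_kernelCone {s : ℝ} {T : Set ℂ} {f : C(disc, ℝ)}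
    (hf : f ∈ kernelCone s T) (z : disc) : 0 ≤ f z := by
  refine kernelCone_inequality (evalAt z) ?_ hf
  rintro g ⟨β, -, hβ, hg⟩
  simp only [ContinuousMap.evalCLM_apply, hg]
  positivity

theorem kernel_le {s : ℝ} (hs : 0 < s) {z w β : ℂ} (hz : z ∈ disc) (hw : w ∈ disc)
    (hβ : 1 ≤ β.re) :
    1 / ‖z + β‖ ^ (2 * s) ≤ 2 ^ (2 * s) * (1 / ‖w + β‖ ^ (2 * s)) := by
  have h1 := one_le_norm_add_of_one_le_re hz hβ
  have h2 := one_le_norm_add_of_one_le_re hw hβ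
  have h3 : ‖w + β‖ ≤ 2 * ‖z + β‖ := by
    have h := norm_sub_le_one hz hw
    have : ‖w + β‖ ≤ ‖w - z‖ + ‖z + β‖ := by
      calc ‖w + β‖ = ‖(w - z) + (z + β)‖ := by ring_nf
        _ ≤ _ := norm_add_le _ _
    linarith
  have h4 : ‖w + β‖ ^ (2 * s) ≤ 2 ^ (2 * s) * ‖z + β‖ ^ (2 * s) := by
    rw [← Real.mul_rpow (by norm_num) (norm_nonneg _)]
    exact Real.rpow_le_rpow (norm_nonneg _) h3 (by linarith)
  have h5 : 0 < ‖w + β‖ ^ (2 * s) := Real.rpow_pos_of_pos (by linarith) _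
  have h6 : 0 < ‖z + β‖ ^ (2 * s) := Real.rpow_pos_of_pos (by linarith) _
  rw [mul_one_div, div_le_div_iff₀ h6 h5, one_mul]
  exact h4

/-- The constant does not depend on `f`, so a cone element that vanishes at one point vanishes
identically; this makes the eigenfunction strictly positive. -/
theorem harnack_of_mem_kernelCone {s : ℝ} (hs : 0 < s) {T : Set ℂ} {f : C(disc, ℝ)}
    (hf : f ∈ kernelCone s T) (z w : disc) : f z ≤ 2 ^ (2 * s) * f w := by
  have := kernelCone_inequality ((2 : ℝ) ^ (2 * s) • evalAt w - evalAt z) ?_ hf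
  · simpa using this
  · rintro g ⟨β, -, hβ, hg⟩
    simpa [hg] using kernel_le hs z.2 w.2 hβ

/-- Write `(a / b)^p` as an exponential and use `exp t ≥ 1 + t` with `log (b / a) ≤ b / a - 1 ≤ |a -
b|`. The bound keeps the factor `1 / a ^ p`, so that it is linear in the kernel and passes to the
cone. -/
theorem inv_rpow_sub_le {a b p : ℝ} (ha : 1 ≤ a) (hb : 1 ≤ b) (hp : 0 < p) :
    1 / a ^ p - 1 / b ^ p ≤ p * |a - b| * (1 / a ^ p) := by
  have ha0 : 0 < a := by linarith
  have hb0 : 0 < b := by linarith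
  have hap : 0 < a ^ p := Real.rpow_pos_of_pos ha0 _
  have hbp : 0 < b ^ p := Real.rpow_pos_of_pos hb0 _
  have key : 1 - p * |a - b| ≤ a ^ p / b ^ p := by
    rw [← Real.div_rpow ha0.le hb0.le, Real.rpow_def_of_pos (by positivity)]
    have h1 := Real.add_one_le_exp (Real.log (a / b) * p)
    have h2 : -Real.log (a / b) ≤ |a - b| := by
      rw [← Real.log_inv, inv_div]
      have := Real.log_le_sub_one_of_pos (show 0 < b / a by positivity)
      have h3 : b / a - 1 = (b - a) / a := by field_simp
      have h4 : (b - a) / a ≤ |a - b| / a := by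
        gcongr; rw [abs_sub_comm]; exact le_abs_self _
      have h5 : |a - b| / a ≤ |a - b| := div_le_self (abs_nonneg _) ha
      linarith
    nlinarith
  have h6 : 1 / b ^ p = a ^ p / b ^ p * (1 / a ^ p) := by field_simp
  have h7 : 0 < 1 / a ^ p := by positivity
  rw [h6]
  nlinarith

theorem sub_le_of_mem_kernelCone {s : ℝ} (hs : 0 < s) {T : Set ℂ} {f : C(disc, ℝ)}
    (hf : f ∈ kernelCone s T) (z w : disc) :
    f z - f w ≤ 2 * s * dist z w * f z := by
  have := kernelCone_inequality ((2 * s * dist z w) • evalAt z - (evalAt z - evalAt w)) ?_ hf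
  · simpa using this
  · rintro g ⟨β, -, hβ, hg⟩
    have hp : 0 < 2 * s := by linarith
    have h1 := inv_rpow_sub_le (one_le_norm_add_of_one_le_re z.2 hβ)
      (one_le_norm_add_of_one_le_re w.2 hβ) hp
    have h2 : |‖(z : ℂ) + β‖ - ‖(w : ℂ) + β‖| ≤ dist z w := by
      refine (abs_norm_sub_norm_le _ _).trans_eq ?_
      rw [Subtype.dist_eq, dist_eq_norm]; ring_nf
    have h3 : 0 ≤ 1 / ‖(z : ℂ) + β‖ ^ (2 * s) := by positivity
    have h4 : 2 * s * |‖(z : ℂ) + β‖ - ‖(w : ℂ) + β‖| * (1 / ‖(z : ℂ) + β‖ ^ (2 * s)) ≤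
      2 * s * dist z w * (1 / ‖(z : ℂ) + β‖ ^ (2 * s)) := by gcongr
    have := h1.trans h4
    simp [hg] at this ⊢
    linarith

theorem lipschitzWith_of_mem_kernelCone {s : ℝ} (hs : 0 < s) {T : Set ℂ} {f : C(disc, ℝ)}
    (hf : f ∈ kernelCone s T) {M : ℝ≥0} (hM : ‖f‖ ≤ M) :
    LipschitzWith (2 * s.toNNReal * M) f := by
  refine LipschitzWith.of_le_add_mul _ fun z w => ?_
  have h1 := sub_le_of_mem_kernelCone hs hf z w
  have h2 : f z ≤ M := (le_abs_self _).trans ((f.norm_coe_le_norm z).trans hM)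
  have h3 : 2 * s * dist z w * f z ≤ 2 * s * dist z w * M := by gcongr
  simp only [NNReal.coe_mul, NNReal.coe_ofNat, Real.coe_toNNReal s hs.le]
  linarith

/-- A strict inequality need not survive closure of the cone, hence a ratio `q < 1` uniform over all
kernels; boundedness of `T` provides it. -/
theorem strictAnti_of_mem_kernelCone {s : ℝ} (hs : 0 < s) {T : Set ℂ} {R : ℝ}
    (hT : ∀ β ∈ T, ‖β‖ ≤ R) {z w : disc} (him : (z : ℂ).im = (w : ℂ).im)
    (hre : (z : ℂ).re < (w : ℂ).re) : ∃ q < (1 : ℝ), ∀ f ∈ kernelCone s T, f w ≤ q * f z := by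
  by_cases hne : ∃ β ∈ T, 1 ≤ β.re
  swap
  -- There are no kernels, and the cone is zero.
  · refine ⟨0, one_pos, fun f hf => ?_⟩
    have := kernelCone_inequality (-evalAt w) ?_ hf
    · simpa using this
    · rintro g ⟨β, h1, hβ, hg⟩
      exact absurd ⟨β, h1, hβ⟩ hne
  have hR : 1 ≤ R := by
    obtain ⟨β, h1, h2⟩ := hne
    exact h2.trans ((Complex.re_le_norm _).trans (hT β h1))
  set d := (w : ℂ).re - (z : ℂ).re with hd
  have hd0 : 0 < d := by linarith
  set N : ℝ := 1 + R with hN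
  have hN0 : 0 < N := by linarith
  set κ : ℝ := 1 + d / N ^ 2 with hκ
  have hκ1 : 1 < κ := by
    have : 0 < d / N ^ 2 := by positivity
    linarith
  refine ⟨1 / κ ^ (2 * s), ?_, fun f hf => ?_⟩
  · rw [div_lt_one (by positivity)]
    exact Real.one_lt_rpow hκ1 (by linarith)
  have := kernelCone_inequality ((1 / κ ^ (2 * s)) • evalAt z - evalAt w) ?_ hf
  · simpa using this
  rintro g ⟨β, hβT, hβ, hg⟩
  have ha := one_le_norm_add_of_one_le_re z.2 hβ
  have hb := one_le_norm_add_of_one_le_re w.2 hβ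
  have hnorm : ∀ u : disc, ‖(u : ℂ) + β‖ ≤ N := fun u => by
    have := norm_sub_le_one zero_mem_disc u.2
    rw [sub_zero] at this
    exact (norm_add_le _ _).trans (add_le_add this (hT β hβT))
  -- The difference of squares is `d (2 re z + 2 re β + d)`, with `re z ≥ 0` and `re β ≥ 1`.
  -- Dividing by the sum of the norms, at most `2 N`, gives a gap of at least `d / N`.
  have hsq : ‖(z : ℂ) + β‖ ^ 2 + 2 * d ≤ ‖(w : ℂ) + β‖ ^ 2 := by
    rw [← Complex.normSq_eq_norm_sq, ← Complex.normSq_eq_norm_sq, Complex.normSq_apply,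
      Complex.normSq_apply]
    simp only [Complex.add_re, Complex.add_im, him]
    have := re_nonneg_of_mem_disc z.2
    nlinarith
  have hle : κ * ‖(z : ℂ) + β‖ ≤ ‖(w : ℂ) + β‖ := by
    have hz := hnorm z
    have hw := hnorm w
    have h1 : d / N ^ 2 * ‖(z : ℂ) + β‖ ≤ d / N := by
      calc d / N ^ 2 * ‖(z : ℂ) + β‖ ≤ d / N ^ 2 * N := by gcongr
        _ = d / N := by field_simp
    have h2 : d / N ≤ ‖(w : ℂ) + β‖ - ‖(z : ℂ) + β‖ := by
      rw [div_le_iff₀ hN0]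
      nlinarith
    rw [hκ]; linarith
  have h1 : κ ^ (2 * s) * ‖(z : ℂ) + β‖ ^ (2 * s) ≤ ‖(w : ℂ) + β‖ ^ (2 * s) := by
    rw [← Real.mul_rpow (by linarith) (norm_nonneg _)]
    exact Real.rpow_le_rpow (by positivity) hle (by linarith)
  have h2 : 0 < ‖(z : ℂ) + β‖ ^ (2 * s) := Real.rpow_pos_of_pos (by linarith) _
  have h3 : 1 / ‖(w : ℂ) + β‖ ^ (2 * s) ≤
      1 / κ ^ (2 * s) * (1 / ‖(z : ℂ) + β‖ ^ (2 * s)) := by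
    rw [one_div_mul_one_div]
    exact one_div_le_one_div_of_le (by positivity) h1
  simpa [hg] using h3

theorem criticalExponent_nonneg (B : Set ℂ) : 0 ≤ criticalExponent B :=
  Real.sInf_nonneg fun _ h => h.1.le

/-! ### Positivity of the operator and invariance of the cone. -/

section Operator

variable {B : Set ℂ} {hB : B ⊆ indexSet} {s : ℝ} {hs : criticalExponent B < s}

theorem summable_transferOp_term (hs : criticalExponent B < s) (f : C(disc, ℝ)) (z : disc) :
    Summable fun b : B => 1 / ‖(z : ℂ) + (b : ℂ)‖ ^ (2 * s) * f (theta b (hB b.2) z) := by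
  obtain ⟨u, hu, h⟩ := exists_bound hB hs
  exact Summable.of_norm_bounded (hu.mul_right ‖f‖) fun b => norm_term_le hB f h b z

theorem transferOp_mono {f g : C(disc, ℝ)} (h : ∀ z, f z ≤ g z) (z : disc) :
    transferOp B hB s hs f z ≤ transferOp B hB s hs g z := by
  rw [transferOp_apply, transferOp_apply]
  refine (summable_transferOp_term hs f z).tsum_le_tsum (fun b => ?_)
    (summable_transferOp_term hs g z)
  gcongr
  exact h _

theorem transferOp_pow_mono {f g : C(disc, ℝ)} (h : ∀ z, f z ≤ g z) (k : ℕ) (z : disc) :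
    (transferOp B hB s hs ^ k) f z ≤ (transferOp B hB s hs ^ k) g z := by
  induction k generalizing z with
  | zero => simpa using h z
  | succ k ih =>
    rw [pow_succ', mul_apply_eq_comp, mul_apply_eq_comp]
    exact transferOp_mono ih z

theorem transferOp_pos (hne : B.Nonempty) {f : C(disc, ℝ)} (h : ∀ z, 0 < f z) (z : disc) :
    0 < transferOp B hB s hs f z := by
  rw [transferOp_apply]
  obtain ⟨b, hb⟩ := hne
  have hpos : ∀ b : B, 0 < 1 / ‖(z : ℂ) + (b : ℂ)‖ ^ (2 * s) * f (theta b (hB b.2) z) :=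
    fun b => mul_pos (one_div_pos.2 (Real.rpow_pos_of_pos
      (zero_lt_one.trans_le (one_le_norm_add z.2 (hB b.2))) _)) (h _)
  exact (summable_transferOp_term hs f z).tsum_pos (fun b => (hpos b).le) ⟨b, hb⟩ (hpos _)

/-- Each term of the operator maps the kernel at `β` to a multiple of the kernel at `b + 1 / β`. -/
theorem kernel_comp (s : ℝ) {z b β : ℂ} (hz : z ∈ disc) (hb : b ∈ indexSet) (hβ : 1 ≤ β.re) :
    1 / ‖z + b‖ ^ (2 * s) * (1 / ‖1 / (z + b) + β‖ ^ (2 * s)) =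
      1 / ‖β‖ ^ (2 * s) * (1 / ‖z + (b + 1 / β)‖ ^ (2 * s)) := by
  have h0 := add_ne_zero_of_mem hz hb
  have hβ0 : β ≠ 0 := fun h => by rw [h] at hβ; norm_num at hβ
  rw [one_div_mul_one_div, one_div_mul_one_div,
    ← Real.mul_rpow (norm_nonneg _) (norm_nonneg _),
    ← Real.mul_rpow (norm_nonneg _) (norm_nonneg _), ← norm_mul, ← norm_mul]
  congr 3
  field_simp
  ring_nf

theorem one_le_re_add_one_div {b β : ℂ} (hb : b ∈ indexSet) (hβ : 1 ≤ β.re) :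
    1 ≤ (b + 1 / β).re := by
  have h1 := one_le_re_of_mem_indexSet hb
  have h2 := re_nonneg_of_mem_disc (inv_mem_disc hβ)
  rw [Complex.add_re]; linarith

/-- By `kernel_comp` the image of a kernel is a series of nonnegative multiples of kernels; it
converges in the sup norm, so its sum stays in the closed cone. -/
theorem transferOp_mem_kernelCone {T : Set ℂ} (hT : ∀ b ∈ B, ∀ β ∈ T, b + 1 / β ∈ T)
    {f : C(disc, ℝ)} (hf : f ∈ kernelCone s T) : transferOp B hB s hs f ∈ kernelCone s T := by
  have hcl := (isClosed_kernelCone s T).preimage (transferOp B hB s hs).continuous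
  let P : Submodule ℝ≥0 C(disc, ℝ) :=
    (kernelCone s T).comap ((transferOp B hB s hs).toLinearMap.restrictScalars ℝ≥0)
  refine kernelCone_le (P := P) hcl ?_ hf
  rintro g ⟨β, hβT, hβ, hg⟩
  change transferOp B hB s hs g ∈ kernelCone s T
  have hex : ∀ b : B, ∃ h : C(disc, ℝ), ∀ z, h z = 1 / ‖(z : ℂ) + ((b : ℂ) + 1 / β)‖ ^ (2 * s) :=
    fun b => exists_kernel s (one_le_re_add_one_div (hB b.2) hβ)
  choose k hk using hex
  set c : ℝ≥0 := ⟨1 / ‖β‖ ^ (2 * s), by positivity⟩ with hc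
  have hterm : ∀ (b : B) (z : disc), (c • k b) z =
      1 / ‖(z : ℂ) + (b : ℂ)‖ ^ (2 * s) * g (theta b (hB b.2) z) := fun b z => by
    rw [hg]
    change (1 / ‖β‖ ^ (2 * s)) * k b z = _
    rw [hk]
    exact (kernel_comp s z.2 (hB b.2) hβ).symm
  obtain ⟨u, hu, h⟩ := exists_bound hB hs
  have hu0 : ∀ b, 0 ≤ u b := fun b =>
    (show (0 : ℝ) ≤ _ by positivity).trans (h 0 zero_mem_disc b)
  have hsum : Summable fun b : B => c • k b := by
    refine Summable.of_norm_bounded (hu.mul_right ‖g‖) fun b => ?_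
    rw [ContinuousMap.norm_le _ (mul_nonneg (hu0 b) (norm_nonneg _))]
    intro z
    rw [hterm]
    exact norm_term_le hB g h b z
  have heq : transferOp B hB s hs g = ∑' b : B, c • k b := by
    ext z
    rw [transferOp_apply, ← ContinuousMap.tsum_apply hsum]
    exact tsum_congr fun b => (hterm b z).symm
  rw [heq]
  refine (isClosed_kernelCone s T).mem_of_tendsto hsum.hasSum (Eventually.of_forall fun S => ?_)
  exact Submodule.sum_mem _ fun b _ => Submodule.smul_mem _ _ (kernelSet_subset_kernelCone s T
    ⟨_, hT b b.2 β hβT, one_le_re_add_one_div (hB b.2) hβ, hk b⟩)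

theorem transferOp_pow_mem_kernelCone {T : Set ℂ} (hT : ∀ b ∈ B, ∀ β ∈ T, b + 1 / β ∈ T)
    {f : C(disc, ℝ)} (hf : f ∈ kernelCone s T) (k : ℕ) :
    (transferOp B hB s hs ^ k) f ∈ kernelCone s T := by
  induction k with
  | zero => simpa using hf
  | succ k ih =>
    rw [pow_succ', mul_apply_eq_comp]
    exact transferOp_mem_kernelCone hT ih

/-! ### Contraction by `θ_b`, uniqueness, and growth of the powers. -/

theorem dist_theta (b : ℂ) (hb : b ∈ indexSet) (z w : disc) :
    dist (theta b hb z) (theta b hb w) = dist z w / (‖(z : ℂ) + b‖ * ‖(w : ℂ) + b‖) := by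
  have h1 := add_ne_zero_of_mem z.2 hb
  have h2 := add_ne_zero_of_mem w.2 hb
  rw [Subtype.dist_eq, Subtype.dist_eq, dist_comm (z : ℂ), dist_eq_norm, dist_eq_norm, ← norm_mul,
    ← norm_div]
  congr 1
  change 1 / ((z : ℂ) + b) - 1 / ((w : ℂ) + b) = _
  field_simp
  ring

/-- Both norms in the denominator of `dist_theta` are at least `1`. Since real parts are also at
least `1`, equality would force `z + b = 1 = w + b`. -/
theorem dist_theta_lt (b : ℂ) (hb : b ∈ indexSet) {z w : disc} (hzw : z ≠ w) :
    dist (theta b hb z) (theta b hb w) < dist z w := by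
  rw [dist_theta]
  have hd : 0 < dist z w := dist_pos.2 hzw
  have h1 := one_le_norm_add z.2 hb
  have h2 := one_le_norm_add w.2 hb
  refine div_lt_self hd (lt_of_le_of_ne (one_le_mul_of_one_le_of_one_le h1 h2) fun h => hzw ?_)
  have key : ∀ u : disc, ‖(u : ℂ) + b‖ ≤ 1 → (u : ℂ) + b = 1 := fun u hu => by
    have h3 := one_le_re_add u.2 hb
    have h4 : ‖(u : ℂ) + b‖ ^ 2 ≤ 1 := pow_le_one₀ (norm_nonneg _) hu
    rw [← Complex.normSq_eq_norm_sq, Complex.normSq_apply] at h4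
    refine Complex.ext ?_ ?_
    · rw [Complex.one_re]; nlinarith
    · rw [Complex.one_im]; nlinarith
  have hz := key z (by nlinarith)
  have hw := key w (by nlinarith)
  exact Subtype.ext (add_right_cancel (hz.trans hw.symm))

/-- Two nonempty closed sets that are both invariant under the same `θ_b` meet. -/
theorem exists_mem_inter_of_invariant {b : ℂ} (hb : b ∈ indexSet) {S T : Set disc}
    (hS : IsClosed S) (hT : IsClosed T) (hS0 : S.Nonempty) (hT0 : T.Nonempty)
    (hSb : ∀ z ∈ S, theta b hb z ∈ S) (hTb : ∀ z ∈ T, theta b hb z ∈ T) : (S ∩ T).Nonempty := by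
  have hc : IsCompact (S ×ˢ T) := hS.isCompact.prod hT.isCompact
  -- Take a closest pair of points; if they differed, `θ_b` would move them strictly closer.
  obtain ⟨⟨z, w⟩, ⟨hz, hw⟩, hmin⟩ := hc.exists_isMinOn (hS0.prod hT0)
    (f := fun p : disc × disc => dist p.1 p.2) (by fun_prop)
  by_cases hzw : z = w
  · exact ⟨z, hz, hzw ▸ hw⟩
  · have := hmin (show (theta b hb z, theta b hb w) ∈ S ×ˢ T from ⟨hSb z hz, hTb w hw⟩)
    exact absurd this (not_le.2 (dist_theta_lt b hb hzw))

/-- If `c v ≤ w` with equality at `z₀` and `v`, `w` are eigenfunctions, then equality also holds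
at the images of `z₀`. -/
theorem eq_theta_of_eq {v w : C(disc, ℝ)} {r c : ℝ} (hv : transferOp B hB s hs v = r • v)
    (hw : transferOp B hB s hs w = r • w) (hle : ∀ z, c * v z ≤ w z) {z : disc}
    (hz : c * v z = w z) (b : B) :
    c * v (theta b (hB b.2) z) = w (theta b (hB b.2) z) := by
  -- The value at `z` is a sum of nonnegative terms with positive weights, so each term must vanish.
  have hL : transferOp B hB s hs (w - c • v) z = 0 := by
    rw [map_sub, map_smul, hv, hw]
    simp only [ContinuousMap.sub_apply, ContinuousMap.smul_apply, smul_eq_mul, ← hz]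
    ring
  rw [transferOp_apply] at hL
  have hnn : ∀ b : B, 0 ≤ 1 / ‖(z : ℂ) + (b : ℂ)‖ ^ (2 * s) *
      (w - c • v) (theta b (hB b.2) z) := fun b =>
    mul_nonneg (by positivity) (by simpa using hle _)
  have h0 := (hasSum_zero_iff_of_nonneg hnn).1
    (hL ▸ (summable_transferOp_term hs (w - c • v) z).hasSum)
  have h1 := congrFun h0 b
  have h2 : 1 / ‖(z : ℂ) + (b : ℂ)‖ ^ (2 * s) ≠ 0 := (one_div_pos.2 (Real.rpow_pos_of_pos
      (zero_lt_one.trans_le (one_le_norm_add z.2 (hB b.2))) _)).ne'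
  have h3 := (mul_eq_zero.1 h1).resolve_left h2
  simp only [ContinuousMap.sub_apply, ContinuousMap.smul_apply, smul_eq_mul] at h3
  linarith

instance : Nonempty disc := ⟨⟨0, zero_mem_disc⟩⟩

theorem eigenfunction_unique (hne : B.Nonempty) {v w : C(disc, ℝ)} {r μ : ℝ}
    (hv0 : ∀ z, 0 < v z) (hw0 : ∀ z, 0 < w z) (hv : transferOp B hB s hs v = r • v)
    (hw : transferOp B hB s hs w = μ • w) : ∃ c : ℝ, w = c • v := by
  have hcont : Continuous fun z => w z / v z :=
    w.continuous.div v.continuous fun z => (hv0 z).ne'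
  obtain ⟨z₀, -, h₀⟩ := isCompact_univ.exists_isMinOn Set.univ_nonempty hcont.continuousOn
  obtain ⟨z₁, -, h₁⟩ := isCompact_univ.exists_isMaxOn Set.univ_nonempty hcont.continuousOn
  set c := w z₀ / v z₀ with hc
  set d := w z₁ / v z₁ with hd
  have hcle : ∀ z, c * v z ≤ w z := fun z => (le_div_iff₀ (hv0 z)).1 (h₀ (Set.mem_univ z))
  have hdle : ∀ z, w z ≤ d * v z := fun z => (div_le_iff₀ (hv0 z)).1 (h₁ (Set.mem_univ z))
  have hc0 : c * v z₀ = w z₀ := div_mul_cancel₀ _ (hv0 z₀).ne'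
  have hd0 : d * v z₁ = w z₁ := div_mul_cancel₀ _ (hv0 z₁).ne'
  -- Apply `L` to `c v ≤ w ≤ d v` and evaluate at the two contact points.
  have hμ : μ = r := by
    have h1 := transferOp_mono (hB := hB) (hs := hs) (f := c • v) (g := w) hcle z₀
    have h2 := transferOp_mono (hB := hB) (hs := hs) (f := w) (g := d • v) hdle z₁
    rw [map_smul, hv, hw] at h1 h2
    simp only [ContinuousMap.smul_apply, smul_eq_mul] at h1 h2
    have h3 : r * w z₀ ≤ μ * w z₀ := by rw [← hc0] at h1 ⊢; linarith
    have h4 : μ * w z₁ ≤ r * w z₁ := by rw [← hd0] at h2 ⊢; linarith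
    exact le_antisymm (le_of_mul_le_mul_right h4 (hw0 z₁)) (le_of_mul_le_mul_right h3 (hw0 z₀))
  subst hμ
  obtain ⟨b, hb⟩ := hne
  -- The upper contact set is written with `-d` and `-w`, so that `eq_theta_of_eq` covers both sets.
  obtain ⟨z, hz0, hz1⟩ := exists_mem_inter_of_invariant (hB hb)
    (S := {z | c * v z = w z}) (T := {z | -d * v z = (-w) z})
    (isClosed_eq (by fun_prop) (by fun_prop)) (isClosed_eq (by fun_prop) (by fun_prop))
    ⟨z₀, hc0⟩ ⟨z₁, by simp [hd0]⟩
    (fun z hz => eq_theta_of_eq hv hw hcle hz ⟨b, hb⟩)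
    (fun z hz => eq_theta_of_eq hv (by rw [map_neg, hw, smul_neg])
      (fun z => by simpa using hdle z) hz ⟨b, hb⟩)
  have hz0' : c * v z = w z := hz0
  have hz1' : -d * v z = -w z := hz1
  have hcd : c = d := mul_right_cancel₀ (hv0 z).ne' (by linarith)
  refine ⟨c, ContinuousMap.ext fun z => le_antisymm ?_ (hcle z)⟩
  rw [hcd]
  exact hdle z

/-- With `m = min v`, one has `r ^ k ≤ ‖L ^ k‖ ≤ (‖v‖ / m) r ^ k`: the lower bound tests on `v`, the
upper one uses `|f| ≤ (‖f‖ / m) v` and positivity. The constant disappears under the `k`-th root. -/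
theorem tendsto_norm_pow_rpow {v : C(disc, ℝ)} {r : ℝ} (hr : 0 < r) (hv0 : ∀ z, 0 < v z)
    (hv : transferOp B hB s hs v = r • v) :
    Tendsto (fun k : ℕ => ‖transferOp B hB s hs ^ k‖ ^ (1 / (k : ℝ))) atTop (𝓝 r) := by
  have hpow : ∀ k : ℕ, (transferOp B hB s hs ^ k) v = r ^ k • v := fun k => by
    induction k with
    | zero => simp
    | succ k ih => rw [pow_succ, mul_apply_eq_comp, hv, map_smul, ih, smul_smul,
        pow_succ, mul_comm]
  have hvn : 0 < ‖v‖ := norm_pos_iff.2 fun h => by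
    have := hv0 ⟨0, zero_mem_disc⟩
    simp [h] at this
  have hlow : ∀ k : ℕ, r ^ k ≤ ‖transferOp B hB s hs ^ k‖ := fun k => by
    have := (transferOp B hB s hs ^ k).le_opNorm v
    rw [hpow, norm_smul, norm_pow, Real.norm_of_nonneg hr.le] at this
    exact le_of_mul_le_mul_right this hvn
  obtain ⟨z₀, -, h₀⟩ := isCompact_univ.exists_isMinOn Set.univ_nonempty v.continuous.continuousOn
  set m := v z₀ with hm
  have hm0 : 0 < m := hv0 z₀
  have hmle : ∀ z, m ≤ v z := fun z => h₀ (Set.mem_univ z)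
  have hup : ∀ k : ℕ, ‖transferOp B hB s hs ^ k‖ ≤ ‖v‖ / m * r ^ k := fun k => by
    refine ContinuousLinearMap.opNorm_le_bound _ (by positivity) fun f => ?_
    rw [ContinuousMap.norm_le _ (by positivity)]
    intro z
    have hf : ∀ z, |f z| ≤ ‖f‖ / m * v z := fun z => by
      have := f.norm_coe_le_norm z
      rw [Real.norm_eq_abs] at this
      refine this.trans ?_
      rw [div_mul_eq_mul_div, le_div_iff₀ hm0]
      exact mul_le_mul_of_nonneg_left (hmle z) (norm_nonneg _)
    have hb : (transferOp B hB s hs ^ k) ((‖f‖ / m) • v) z ≤ ‖v‖ / m * r ^ k * ‖f‖ := by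
      rw [map_smul, hpow]
      simp only [ContinuousMap.smul_apply, smul_eq_mul]
      have hvz : v z ≤ ‖v‖ := (le_abs_self _).trans (v.norm_coe_le_norm z)
      calc ‖f‖ / m * (r ^ k * v z) ≤ ‖f‖ / m * (r ^ k * ‖v‖) := by gcongr
        _ = _ := by ring
    rw [Real.norm_eq_abs, abs_le]
    constructor
    · have := transferOp_pow_mono (hB := hB) (hs := hs) (f := -((‖f‖ / m) • v)) (g := f)
        (fun z => (abs_le.1 (hf z)).1) k z
      rw [map_neg, ContinuousMap.neg_apply] at this
      linarith
    · exact (transferOp_pow_mono (hB := hB) (hs := hs) (f := f) (g := (‖f‖ / m) • v)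
        (fun z => (abs_le.1 (hf z)).2) k z).trans hb
  have hC : 0 < ‖v‖ / m := by positivity
  have hroot : ∀ k : ℕ, k ≠ 0 → (r ^ k) ^ (1 / (k : ℝ)) = r := fun k hk => by
    rw [one_div]; exact Real.pow_rpow_inv_natCast hr.le hk
  have hlim : Tendsto (fun k : ℕ => (‖v‖ / m) ^ (1 / (k : ℝ)) * r) atTop (𝓝 r) := by
    have h1 : Tendsto (fun k : ℕ => (‖v‖ / m) ^ (1 / (k : ℝ))) atTop (𝓝 ((‖v‖ / m) ^ (0 : ℝ))) :=
      (Real.continuousAt_const_rpow hC.ne').tendsto.comp tendsto_one_div_atTop_nhds_zero_nat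
    simpa using h1.mul_const r
  refine tendsto_of_tendsto_of_tendsto_of_le_of_le' tendsto_const_nhds hlim ?_ ?_
  · filter_upwards [eventually_ne_atTop 0] with k hk
    calc r = (r ^ k) ^ (1 / (k : ℝ)) := (hroot k hk).symm
      _ ≤ _ := Real.rpow_le_rpow (by positivity) (hlow k) (by positivity)
  · filter_upwards [eventually_ne_atTop 0] with k hk
    calc ‖transferOp B hB s hs ^ k‖ ^ (1 / (k : ℝ)) ≤ (‖v‖ / m * r ^ k) ^ (1 / (k : ℝ)) :=
          Real.rpow_le_rpow (ContinuousLinearMap.opNorm_nonneg _) (hup k) (by positivity)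
      _ = _ := by rw [Real.mul_rpow hC.le (by positivity), hroot k hk]

end Operator

/-- Arzelà–Ascoli: cone elements of norm one share the Lipschitz constant `2 s`. -/
theorem isCompact_kernelCone_inter_sphere {s : ℝ} (hs : 0 < s) (T : Set ℂ) :
    IsCompact ((kernelCone s T : Set C(disc, ℝ)) ∩ Metric.sphere 0 1) := by
  set A := (kernelCone s T : Set C(disc, ℝ)) ∩ Metric.sphere 0 1 with hA
  have hcl : IsClosed A := (isClosed_kernelCone s T).inter Metric.isClosed_sphere
  let e := ContinuousMap.isometryEquivBoundedOfCompact disc ℝ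
  have hc : IsCompact (e.symm ⁻¹' A) := by
    refine BoundedContinuousFunction.arzela_ascoli₂ (Metric.closedBall 0 1)
      (isCompact_closedBall 0 1) _ (hcl.preimage e.symm.continuous) ?_ ?_
    · intro f x hf
      have h1 : ‖e.symm f‖ = 1 := by simpa using hf.2
      have h2 := (e.symm f).norm_coe_le_norm x
      rw [h1] at h2
      rw [mem_closedBall_zero_iff]
      exact h2
    · refine (LipschitzWith.uniformEquicontinuous (K := 2 * s.toNNReal * 1) _
        fun f => ?_).equicontinuous
      have h1 : ‖e.symm f.1‖ = 1 := by simpa using f.2.2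
      exact lipschitzWith_of_mem_kernelCone hs f.2.1 (by simp [h1])
  have := hc.image e.symm.continuous
  rwa [Set.image_preimage_eq _ e.symm.surjective] at this

/-! ### Existence of the eigenfunction through Neumann series. -/

section Operator

variable {B : Set ℂ} {hB : B ⊆ indexSet} {s : ℝ} {hs : criticalExponent B < s}

theorem pow_le_of_transferOp_le {F : C(disc, ℝ)} {ρ : ℝ} (hρ : 0 ≤ ρ)
    (h : ∀ z, transferOp B hB s hs F z ≤ ρ * F z) (k : ℕ) (z : disc) :
    (transferOp B hB s hs ^ k) F z ≤ ρ ^ k * F z := by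
  induction k generalizing z with
  | zero => simp
  | succ k ih =>
    have h1 := transferOp_pow_mono (hB := hB) (hs := hs) (f := transferOp B hB s hs F)
      (g := ρ • F) h k z
    rw [pow_succ, mul_apply_eq_comp]
    refine h1.trans ?_
    rw [map_smul, ContinuousMap.smul_apply, smul_eq_mul, pow_succ, mul_comm (ρ ^ k), mul_assoc]
    exact mul_le_mul_of_nonneg_left (ih z) hρ

theorem le_pow_of_le_transferOp {F : C(disc, ℝ)} {ρ : ℝ} (hρ : 0 ≤ ρ)
    (h : ∀ z, ρ * F z ≤ transferOp B hB s hs F z) (k : ℕ) (z : disc) :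
    ρ ^ k * F z ≤ (transferOp B hB s hs ^ k) F z := by
  induction k generalizing z with
  | zero => simp
  | succ k ih =>
    have h1 := transferOp_pow_mono (hB := hB) (hs := hs) (f := ρ • F)
      (g := transferOp B hB s hs F) h k z
    rw [pow_succ (transferOp B hB s hs), mul_apply_eq_comp]
    refine le_trans ?_ h1
    rw [map_smul, ContinuousMap.smul_apply, smul_eq_mul, pow_succ, mul_comm (ρ ^ k), mul_assoc]
    exact mul_le_mul_of_nonneg_left (ih z) hρ

theorem exists_pos_le (f : C(disc, ℝ)) (hf : ∀ z, 0 < f z) : ∃ m > 0, ∀ z, m ≤ f z := by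
  obtain ⟨z₀, -, h₀⟩ := isCompact_univ.exists_isMinOn Set.univ_nonempty f.continuous.continuousOn
  exact ⟨f z₀, hf z₀, fun z => h₀ (Set.mem_univ z)⟩

theorem norm_pos_of_pos {f : C(disc, ℝ)} (hf : ∀ z, 0 < f z) : 0 < ‖f‖ :=
  norm_pos_iff.2 fun h => by
    have := hf ⟨0, zero_mem_disc⟩
    simp [h] at this

/-- The set of `μ > 0` for which the Neumann series `∑ μ⁻ᵏ Lᵏ u` converges absolutely. -/
def neumannSet (L : C(disc, ℝ) →L[ℝ] C(disc, ℝ)) (u : C(disc, ℝ)) : Set ℝ :=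
  {μ | 0 < μ ∧ Summable fun k : ℕ => ‖(μ⁻¹ ^ k) • (L ^ k) u‖}

theorem neumannSet_nonempty (L : C(disc, ℝ) →L[ℝ] C(disc, ℝ)) (u : C(disc, ℝ)) :
    (neumannSet L u).Nonempty := by
  have h0 : 0 < ‖L‖ + 1 := by positivity
  refine ⟨‖L‖ + 1, h0, ?_⟩
  have hg : Summable fun k : ℕ => (‖L‖ / (‖L‖ + 1)) ^ k * ‖u‖ :=
    (summable_geometric_of_lt_one (by positivity)
      ((div_lt_one h0).2 (lt_add_one _))).mul_right _
  refine Summable.of_nonneg_of_le (fun k => norm_nonneg _) (fun k => ?_) hg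
  rw [norm_smul, norm_pow, norm_inv, Real.norm_of_nonneg h0.le, div_pow, inv_pow,
    div_mul_eq_mul_div, div_eq_inv_mul (‖L‖ ^ k * ‖u‖)]
  gcongr
  refine ((L ^ k).le_opNorm u).trans ?_
  gcongr
  exact norm_pow_le L k

/-- Since `L u ≥ c u` for some `c > 0`, the terms of the series do not tend to zero when `μ < c`. -/
theorem sInf_neumannSet_pos (hne : B.Nonempty) {u : C(disc, ℝ)} (hu : ∀ z, 0 < u z) :
    0 < sInf (neumannSet (transferOp B hB s hs) u) := by
  obtain ⟨m, hm, hmle⟩ := exists_pos_le _ (transferOp_pos (hB := hB) (hs := hs) hne hu)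
  have hun := norm_pos_of_pos hu
  set c := m / ‖u‖ with hc
  have hc0 : 0 < c := by positivity
  have hcL : ∀ z, c * u z ≤ transferOp B hB s hs u z := fun z => by
    refine le_trans ?_ (hmle z)
    rw [hc, div_mul_eq_mul_div, div_le_iff₀ hun]
    exact mul_le_mul_of_nonneg_left ((le_abs_self _).trans (u.norm_coe_le_norm z)) hm.le
  refine hc0.trans_le (le_csInf (neumannSet_nonempty _ _) ?_)
  rintro μ ⟨hμ, hsum⟩
  by_contra! hlt
  let z₀ : disc := ⟨0, zero_mem_disc⟩
  have h1 : ∀ k : ℕ, u z₀ ≤ ‖(μ⁻¹ ^ k) • (transferOp B hB s hs ^ k) u‖ := fun k => by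
    refine le_trans ?_ ((Real.le_norm_self _).trans (ContinuousMap.norm_coe_le_norm _ z₀))
    rw [ContinuousMap.smul_apply, smul_eq_mul]
    have h2 := le_pow_of_le_transferOp hc0.le hcL k z₀
    have h3 : 1 ≤ μ⁻¹ ^ k * c ^ k := by
      rw [← mul_pow]
      refine one_le_pow₀ ?_
      rw [inv_mul_eq_div, one_le_div hμ]; exact hlt.le
    calc u z₀ ≤ μ⁻¹ ^ k * c ^ k * u z₀ := le_mul_of_one_le_left (hu z₀).le h3
      _ = μ⁻¹ ^ k * (c ^ k * u z₀) := by ring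
      _ ≤ _ := by gcongr
  exact absurd (ge_of_tendsto' hsum.tendsto_atTop_zero h1) (not_le.2 (hu z₀))

/-- The Neumann series solves `L F = μ (F - u)` inside every closed cone of positive functions
that is invariant under `L`. -/
theorem exists_neumann {T : Set ℂ} (hT : ∀ b ∈ B, ∀ β ∈ T, b + 1 / β ∈ T) {u : C(disc, ℝ)}
    (huT : u ∈ kernelCone s T) {μ : ℝ} (hμ : μ ∈ neumannSet (transferOp B hB s hs) u) :
    ∃ F ∈ kernelCone s T, transferOp B hB s hs F = μ • (F - u) ∧ ∀ z, u z ≤ F z := by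
  obtain ⟨hμ0, hsum⟩ := hμ
  set a : ℕ → C(disc, ℝ) := fun k => (μ⁻¹ ^ k) • (transferOp B hB s hs ^ k) u with ha
  have hsa : Summable a := hsum.of_norm
  have hmem : ∀ k, a k ∈ kernelCone s T := fun k =>
    Submodule.smul_mem (kernelCone s T) (⟨μ⁻¹ ^ k, by positivity⟩ : ℝ≥0)
      (transferOp_pow_mem_kernelCone hT huT k)
  have ha0 : a 0 = u := by simp [ha]
  have hsplit : (∑' k, a k) = u + ∑' k, a (k + 1) := by rw [hsa.tsum_eq_zero_add, ha0]
  have hmemsum : ∀ g : ℕ → C(disc, ℝ), Summable g → (∀ k, g k ∈ kernelCone s T) →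
      ∑' k, g k ∈ kernelCone s T := fun g hg hgm =>
    (isClosed_kernelCone s T).mem_of_tendsto hg.hasSum
      (Eventually.of_forall fun S => Submodule.sum_mem _ fun k _ => hgm k)
  have hs1 : Summable fun k => a (k + 1) := (summable_nat_add_iff 1).2 hsa
  refine ⟨∑' k, a k, hmemsum a hsa hmem, ?_, fun z => ?_⟩
  · rw [ContinuousLinearMap.map_tsum _ hsa, hsplit, add_sub_cancel_left,
      ← tsum_const_smul'' ]
    refine tsum_congr fun k => ?_
    simp only [ha]
    rw [map_smul, smul_smul, pow_succ' (transferOp B hB s hs), mul_apply_eq_comp]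
    congr 1
    rw [pow_succ]
    field_simp
  · rw [hsplit, ContinuousMap.add_apply]
    exact le_add_of_nonneg_right (nonneg_of_mem_kernelCone
      (hmemsum (fun k => a (k + 1)) hs1 fun k => hmem _) z)

/-- From `u ≥ (m / ‖F‖) F` follows `L F ≤ ρ F` with `ρ = μ (1 - m / ‖F‖)`, hence `L^k u ≤ ρ^k F` and
convergence for every `ν > ρ`. Read backwards, this forces `‖F‖ → ∞` as `μ` approaches the infimum.
-/
theorem sInf_neumannSet_le {u F : C(disc, ℝ)} {m μ : ℝ} (hm : 0 < m) (hu : ∀ z, m ≤ u z)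
    (hμ : 0 < μ) (hF : transferOp B hB s hs F = μ • (F - u)) (huF : ∀ z, u z ≤ F z)
    (hLF : ∀ z, 0 ≤ transferOp B hB s hs F z) :
    sInf (neumannSet (transferOp B hB s hs) u) ≤ μ * (1 - m / ‖F‖) := by
  have hF0 : ∀ z, 0 < F z := fun z => hm.trans_le ((hu z).trans (huF z))
  have hFn := norm_pos_of_pos hF0
  set ρ := μ * (1 - m / ‖F‖) with hρ
  have hle : ∀ z, transferOp B hB s hs F z ≤ ρ * F z := fun z => by
    rw [hF]
    simp only [ContinuousMap.smul_apply, ContinuousMap.sub_apply, smul_eq_mul]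
    have h1 : m / ‖F‖ * F z ≤ u z := by
      refine le_trans ?_ (hu z)
      rw [div_mul_eq_mul_div, div_le_iff₀ hFn]
      exact mul_le_mul_of_nonneg_left ((le_abs_self _).trans (F.norm_coe_le_norm z)) hm.le
    calc μ * (F z - u z) ≤ μ * (F z - m / ‖F‖ * F z) := by gcongr
      _ = _ := by rw [hρ]; ring
  let z₀ : disc := ⟨0, zero_mem_disc⟩
  have hρ0 : 0 ≤ ρ := by
    by_contra! h
    have := (hLF z₀).trans (hle z₀)
    nlinarith [hF0 z₀]
  refine le_of_forall_gt_imp_ge_of_dense fun ν hν => ?_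
  have hν0 : 0 < ν := hρ0.trans_lt hν
  refine csInf_le ⟨0, fun x hx => hx.1.le⟩ ⟨hν0, ?_⟩
  have hg : Summable fun k : ℕ => (ρ / ν) ^ k * ‖F‖ :=
    (summable_geometric_of_lt_one (by positivity) ((div_lt_one hν0).2 hν)).mul_right _
  refine Summable.of_nonneg_of_le (fun k => norm_nonneg _) (fun k => ?_) hg
  rw [norm_smul, norm_pow, norm_inv, Real.norm_of_nonneg hν0.le, div_pow, inv_pow,
    div_mul_eq_mul_div, div_eq_inv_mul]
  gcongr
  rw [ContinuousMap.norm_le _ (by positivity)]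
  intro z
  have h0 : 0 ≤ (transferOp B hB s hs ^ k) u z := by
    have := transferOp_pow_mono (hB := hB) (hs := hs) (f := 0) (g := u)
      (fun z => hm.le.trans (hu z)) k z
    simpa using this
  rw [Real.norm_of_nonneg h0]
  calc (transferOp B hB s hs ^ k) u z ≤ (transferOp B hB s hs ^ k) F z :=
        transferOp_pow_mono huF k z
    _ ≤ ρ ^ k * F z := pow_le_of_transferOp_le hρ0 hle k z
    _ ≤ ρ ^ k * ‖F‖ := by
      gcongr
      exact (le_abs_self _).trans (F.norm_coe_le_norm z)

theorem exists_eigenfunction (hne : B.Nonempty) {T : Set ℂ}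
    (hT : ∀ b ∈ B, ∀ β ∈ T, b + 1 / β ∈ T) (hT1 : (1 : ℂ) ∈ T) :
    ∃ v ∈ kernelCone s T, ∃ r : ℝ, 0 < r ∧ (∀ z, 0 < v z) ∧ transferOp B hB s hs v = r • v := by
  have hs0 : 0 < s := (criticalExponent_nonneg B).trans_lt hs
  have h1re : 1 ≤ (1 : ℂ).re := by simp
  obtain ⟨u, hu⟩ := exists_kernel s h1re
  have huT : u ∈ kernelCone s T := kernelSet_subset_kernelCone s T ⟨1, hT1, h1re, hu⟩
  have hu0 : ∀ z, 0 < u z := fun z => by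
    rw [hu]
    exact one_div_pos.2 (Real.rpow_pos_of_pos
      (zero_lt_one.trans_le (one_le_norm_add_of_one_le_re z.2 h1re)) _)
  obtain ⟨m, hm, hmu⟩ := exists_pos_le u hu0
  set S := neumannSet (transferOp B hB s hs) u with hS
  set r := sInf S with hr
  have hr0 : 0 < r := sInf_neumannSet_pos hne hu0
  obtain ⟨μ, -, hμlim, hμS⟩ :=
    exists_seq_tendsto_sInf (neumannSet_nonempty (transferOp B hB s hs) u)
      ⟨0, fun x hx => hx.1.le⟩
  choose F hFT hF huF using fun n => exists_neumann hT huT (hμS n)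
  have hμ0 : ∀ n, 0 < μ n := fun n => (hμS n).1
  have hF0 : ∀ n z, 0 < F n z := fun n z => (hu0 z).trans_le (huF n z)
  have hFn : ∀ n, 0 < ‖F n‖ := fun n => norm_pos_of_pos (hF0 n)
  have hbound : ∀ n, ‖F n‖⁻¹ ≤ m⁻¹ * (1 - r / μ n) := fun n => by
    have := sInf_neumannSet_le hm hmu (hμ0 n) (hF n) (huF n)
      (fun z => (transferOp_pos hne (hF0 n) z).le)
    rw [← div_le_iff₀' (hμ0 n)] at this
    rw [← div_eq_inv_mul, le_div_iff₀' hm, ← div_eq_mul_inv]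
    linarith
  have hinv : Tendsto (fun n => ‖F n‖⁻¹) atTop (𝓝 0) := by
    have hlim : Tendsto (fun n => m⁻¹ * (1 - r / μ n)) atTop (𝓝 (m⁻¹ * (1 - r / r))) :=
      (tendsto_const_nhds.sub (tendsto_const_nhds.div hμlim hr0.ne')).const_mul _
    rw [div_self hr0.ne', sub_self, mul_zero] at hlim
    exact squeeze_zero (fun n => (inv_pos.2 (hFn n)).le) hbound hlim
  set G : ℕ → C(disc, ℝ) := fun n => ‖F n‖⁻¹ • F n with hG
  have hGA : ∀ n, G n ∈ (kernelCone s T : Set C(disc, ℝ)) ∩ Metric.sphere 0 1 := fun n => by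
    refine ⟨Submodule.smul_mem (kernelCone s T)
      (⟨‖F n‖⁻¹, (inv_pos.2 (hFn n)).le⟩ : ℝ≥0) (hFT n), ?_⟩
    rw [mem_sphere_zero_iff_norm, hG]
    simp only [norm_smul, norm_inv, norm_norm]
    exact inv_mul_cancel₀ (hFn n).ne'
  obtain ⟨v, ⟨hvT, hv1⟩, φ, hφ, hlim⟩ :=
    (isCompact_kernelCone_inter_sphere hs0 T).tendsto_subseq hGA
  have hvn : ‖v‖ = 1 := by simpa using hv1
  have hvpos : ∀ z, 0 < v z := fun z => by
    by_contra! h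
    have h0 : v = 0 := by
      ext w
      have h1 := harnack_of_mem_kernelCone hs0 hvT w z
      have h2 := nonneg_of_mem_kernelCone hvT w
      have h3 : (0 : ℝ) < 2 ^ (2 * s) := by positivity
      exact le_antisymm (h1.trans (mul_nonpos_of_nonneg_of_nonpos h3.le h)) h2
    simp [h0] at hvn
  refine ⟨v, hvT, r, hr0, hvpos, ?_⟩
  -- After normalisation the inhomogeneous term carries the factor `‖F n‖⁻¹`, which tends to zero.
  have hLG : ∀ n, transferOp B hB s hs (G n) = μ n • G n - (μ n * ‖F n‖⁻¹) • u := fun n => by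
    simp only [hG]
    rw [map_smul, hF, smul_smul, smul_smul, smul_sub, mul_comm]
  have hl1 : Tendsto (fun n => transferOp B hB s hs (G (φ n))) atTop
      (𝓝 (transferOp B hB s hs v)) :=
    ((transferOp B hB s hs).continuous.tendsto v).comp hlim
  have hl2 : Tendsto (fun n => transferOp B hB s hs (G (φ n))) atTop
      (𝓝 (r • v - (r * 0) • u)) := by
    simp only [hLG]
    have hμφ := hμlim.comp hφ.tendsto_atTop
    exact (hμφ.smul hlim).sub ((hμφ.mul (hinv.comp hφ.tendsto_atTop)).smul_const u)
  rw [tendsto_nhds_unique hl1 hl2]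
  simp

end Operator

/-! ### Smoothness for compact parameter sets. -/

section ContinuousFunctions

variable {X : Type*} [TopologicalSpace X] [CompactSpace X]

theorem exp_apply (f : C(X, ℝ)) (x : X) : NormedSpace.exp f x = Real.exp (f x) := by
  rw [Real.exp_eq_exp_ℝ]
  exact NormedSpace.map_exp (ContinuousMap.evalAlgHom ℝ ℝ x)
    (continuous_eval_const x) f

theorem contDiff_exp_continuousMap :
    ContDiff ℝ ∞ (NormedSpace.exp : C(X, ℝ) → C(X, ℝ)) :=
  contDiff_iff_contDiffAt.2 fun f => (NormedSpace.exp_analytic (𝕂 := ℝ) f).contDiffAt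

/-- Raising positive continuous functions to a real power is smooth in the sup norm. -/
theorem exists_contDiffAt_rpow (p : ℝ) {f₀ : C(X, ℝ)} (hf₀ : ∀ x, 0 < f₀ x) :
    ∃ Ψ : C(X, ℝ) → C(X, ℝ), ContDiffAt ℝ ∞ Ψ f₀ ∧ ∀ᶠ f in 𝓝 f₀, ∀ x, Ψ f x = f x ^ p := by
  let c : C(X, ℝ) := ⟨fun x => Real.log (f₀ x), f₀.continuous.log fun x => (hf₀ x).ne'⟩
  have hc : NormedSpace.exp c = f₀ := by
    ext x
    rw [exp_apply]
    exact Real.exp_log (hf₀ x)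
  let u : C(X, ℝ)ˣ := ⟨NormedSpace.exp c, NormedSpace.exp (-c),
    by ext x; simp [exp_apply, ← Real.exp_add], by ext x; simp [exp_apply, ← Real.exp_add]⟩
  let e : C(X, ℝ) ≃L[ℝ] C(X, ℝ) := ContinuousLinearEquiv.smulLeft u
  -- The derivative of `exp` at `c = log f₀` is multiplication by the unit `f₀`; the inverse
  -- function theorem supplies a smooth local logarithm, and the power is `exp (p log f)`.
  have he : HasFDerivAt (NormedSpace.exp : C(X, ℝ) → C(X, ℝ)) (e : C(X, ℝ) →L[ℝ] C(X, ℝ)) c :=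
    hasFDerivAt_exp (𝕂 := ℝ)
  have hexp : ContDiffAt ℝ ∞ (NormedSpace.exp : C(X, ℝ) → C(X, ℝ)) c :=
    contDiff_exp_continuousMap.contDiffAt
  have hinv := hexp.to_localInverse he (by simp)
  have hright := (hexp.hasStrictFDerivAt' he (by simp)).eventually_right_inverse
  rw [hc] at hinv hright
  refine ⟨fun f => NormedSpace.exp (p • hexp.localInverse he (by simp) f), ?_, ?_⟩
  · exact contDiff_exp_continuousMap.contDiffAt.comp _ (hinv.const_smul p)
  · filter_upwards [hright] with f hf x
    have hfx : f x = Real.exp (hexp.localInverse he (by simp) f x) := by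
      rw [← exp_apply]
      exact (congrArg (fun g : C(X, ℝ) => g x) hf).symm
    rw [exp_apply, hfx, ← Real.exp_mul, ContinuousMap.smul_apply, smul_eq_mul, mul_comm]

end ContinuousFunctions

/-- The kernel as a function of `β ∈ T`, for a fixed `z`. -/
def kernelFamily (s : ℝ) (T : Set ℂ) (z : ℂ) : C(T, ℝ) :=
  -- The default `0` is taken only where continuity in `β` fails; for compact `T` in the half-plane
  -- `1 ≤ re β`, this does not happen near the disc.
  ContinuousMap.mkD (fun β : T => 1 / ‖z + (β : ℂ)‖ ^ (2 * s)) 0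

section Family

variable {s : ℝ} {T : Set ℂ}

/-- The family is the power `-s` of `|z + β|^2`, a quadratic polynomial in `re z`, `im z` with
coefficients in `C(T)`. Smoothness holds in the full plane at each point of the disc, hence up to
the boundary. -/
theorem contDiffAt_kernelFamily [CompactSpace T] (hT : ∀ β ∈ T, 1 ≤ β.re) (z₀ : disc) :
    ContDiffAt ℝ ∞ (kernelFamily s T) z₀ := by
  let R : C(T, ℝ) := ⟨fun β => (β : ℂ).re, by fun_prop⟩
  let J : C(T, ℝ) := ⟨fun β => (β : ℂ).im, by fun_prop⟩
  let a : ℂ → C(T, ℝ) := fun z =>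
    (Complex.reCLM z • (1 : C(T, ℝ)) + R) ^ 2 + (Complex.imCLM z • (1 : C(T, ℝ)) + J) ^ 2
  have haz : ∀ z β, a z β = ‖z + (β : ℂ)‖ ^ 2 := fun z β => by
    rw [← Complex.normSq_eq_norm_sq, Complex.normSq_apply]
    simp [a, R, J, sq]
  have ha : ContDiff ℝ ∞ a := by fun_prop
  have hpos : ∀ β, 0 < a z₀ β := fun β => by
    rw [haz]
    have := one_le_norm_add_of_one_le_re z₀.2 (hT β β.2)
    positivity
  obtain ⟨Ψ, hΨ, hev⟩ := exists_contDiffAt_rpow (-s) hpos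
  refine (hΨ.comp (z₀ : ℂ) ha.contDiffAt).congr_of_eventuallyEq ?_
  filter_upwards [ha.continuous.continuousAt.eventually hev] with z hz
  have hfun : (fun β : T => 1 / ‖z + (β : ℂ)‖ ^ (2 * s)) = Ψ (a z) := by
    ext β
    rw [hz, haz, ← Real.rpow_natCast, ← Real.rpow_mul (norm_nonneg _), one_div,
      ← Real.rpow_neg (norm_nonneg _)]
    congr 1
    push_cast; ring
  unfold kernelFamily
  rw [hfun]
  exact ContinuousMap.mkD_of_continuous (Ψ (a z)).continuous

theorem kernelFamily_apply (hT : ∀ β ∈ T, 1 ≤ β.re) (z : disc) (β : T) :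
    kernelFamily s T z β = 1 / ‖(z : ℂ) + (β : ℂ)‖ ^ (2 * s) := by
  have hp : ∀ β : T, 0 < ‖(z : ℂ) + (β : ℂ)‖ := fun β =>
    zero_lt_one.trans_le (one_le_norm_add_of_one_le_re z.2 (hT β β.2))
  have hc : Continuous fun β : T => ‖(z : ℂ) + (β : ℂ)‖ := by fun_prop
  exact ContinuousMap.mkD_apply_of_continuous (continuous_const.div
    (hc.rpow_const fun β => Or.inl (hp β).ne') fun β => (Real.rpow_pos_of_pos (hp β) _).ne')

/-- Every function in the cone is obtained by applying a functional to the kernel family. -/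
theorem exists_functional_of_mem_kernelCone [CompactSpace T] (hs : 0 < s)
    (hT : ∀ β ∈ T, 1 ≤ β.re) {f : C(disc, ℝ)} (hf : f ∈ kernelCone s T) :
    ∃ Λ : C(T, ℝ) →L[ℝ] ℝ, ∀ z : disc, f z = Λ (kernelFamily s T z) := by
  obtain ⟨R, hR⟩ := (isCompact_iff_compactSpace.2 ‹CompactSpace T›).isBounded.exists_norm_le
  set z₀ : disc := ⟨0, zero_mem_disc⟩ with hz₀
  set C : ℝ := |R| ^ (2 * s) with hC
  have hC0 : 0 ≤ C := by positivity
  let P : Submodule ℝ≥0 C(disc, ℝ) :=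
    -- The norm bound on `Λ` is linear in `f` and makes the condition closed: representing
    -- functionals of a convergent sequence stay in one weak-* compact ball. The constant `C`
    -- dominates `|β|^{2s}` on `T`, so evaluation at `β` satisfies the bound for the kernel at `β`.
    { carrier := {f | ∃ Λ : C(T, ℝ) →L[ℝ] ℝ, (∀ φ, |Λ φ| ≤ C * f z₀ * ‖φ‖) ∧
        ∀ z : disc, f z = Λ (kernelFamily s T z)}
      add_mem' := by
        rintro f g ⟨Λ, h1, h2⟩ ⟨Λ', h1', h2'⟩
        refine ⟨Λ + Λ', fun φ => (abs_add_le (Λ φ) (Λ' φ)).trans ?_, fun z => by simp [h2 z, h2' z]⟩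
        rw [ContinuousMap.add_apply]
        linarith [h1 φ, h1' φ]
      zero_mem' := ⟨0, by simp, by simp⟩
      smul_mem' := by
        rintro c f ⟨Λ, h1, h2⟩
        refine ⟨(c : ℝ) • Λ, fun φ => ?_, fun z => ?_⟩
        · change |(c : ℝ) * Λ φ| ≤ C * (c * f z₀) * ‖φ‖
          rw [abs_mul, NNReal.abs_eq]
          linarith [mul_le_mul_of_nonneg_left (h1 φ) c.coe_nonneg]
        · change (c : ℝ) * f z = (c : ℝ) * Λ _
          rw [h2 z] }
  have hP : IsClosed (P : Set C(disc, ℝ)) := by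
    refine isClosed_of_closure_subset fun f hf => ?_
    obtain ⟨g, hg, hlim⟩ := mem_closure_iff_seq_limit.1 hf
    choose Λ h1 h2 using hg
    have hev : ∀ z : disc, Tendsto (fun n => g n z) atTop (𝓝 (f z)) := fun z =>
      ((continuous_eval_const z).tendsto f).comp hlim
    obtain ⟨M, hM⟩ := (hev z₀).bddAbove_range
    have hf0 : ∀ n, 0 ≤ C * g n z₀ := fun n => by
      have := (abs_nonneg _).trans (h1 n 1)
      by_cases hT0 : Nonempty T
      · rwa [norm_one, mul_one] at this
      · have hE : IsEmpty T := not_nonempty_iff.1 hT0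
        have : g n z₀ = 0 := by
          rw [h2, Subsingleton.elim (kernelFamily s T z₀) 0, map_zero]
        rw [this, mul_zero]
    have hΛM : ∀ n, Λ n ∈ Metric.closedBall (0 : StrongDual ℝ C(T, ℝ)) (C * M) := fun n =>
      (mem_closedBall_zero_iff (E := StrongDual ℝ C(T, ℝ))).2
        ((ContinuousLinearMap.opNorm_le_bound _ (hf0 n) (h1 n)).trans
          (mul_le_mul_of_nonneg_left (hM ⟨n, rfl⟩) hC0))
    have hcomp := WeakDual.isCompact_closedBall (𝕜 := ℝ) (0 : StrongDual ℝ C(T, ℝ)) (C * M)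
    -- A limit along an ultrafilter replaces the choice of a weak-* convergent subsequence.
    let U : Ultrafilter ℕ := Ultrafilter.of atTop
    have hU : (U : Filter ℕ) ≤ atTop := Ultrafilter.of_le atTop
    let Λw : ℕ → WeakDual ℝ C(T, ℝ) := fun n => StrongDual.toWeakDual (Λ n)
    obtain ⟨L, -, hL⟩ := hcomp.ultrafilter_le_nhds (U.map Λw) (by
      rw [le_principal_iff]
      exact Filter.univ_mem' (f := (U : Filter ℕ)) hΛM)
    have hLt : ∀ φ : C(T, ℝ), Tendsto (fun n => Λ n φ) U (𝓝 (L φ)) := fun φ =>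
      ((WeakDual.eval_continuous φ).tendsto L).comp hL
    have hrep : ∀ z : disc, f z = L (kernelFamily s T z) := fun z =>
      tendsto_nhds_unique ((hev z).mono_left hU) (by simpa only [h2] using hLt _)
    refine ⟨WeakDual.toStrongDual L, fun φ => ?_, hrep⟩
    exact le_of_tendsto_of_tendsto' (hLt φ).abs
      ((((hev z₀).mono_left hU).const_mul C).mul_const ‖φ‖) fun n => h1 n φ
  have hgen : kernelSet s T ⊆ P := by
    rintro g ⟨β, hβT, hβ, hg⟩
    refine ⟨ContinuousMap.evalCLM ℝ ⟨β, hβT⟩, fun φ => ?_, fun z => ?_⟩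
    · have h1 : 1 ≤ C * g z₀ := by
        rw [hg, hz₀]
        simp only [zero_add]
        have h2 : 1 ≤ ‖β‖ := hβ.trans (Complex.re_le_norm _)
        rw [mul_one_div, one_le_div (Real.rpow_pos_of_pos (by linarith) _)]
        exact Real.rpow_le_rpow (norm_nonneg _) ((hR β hβT).trans (le_abs_self _)) (by linarith)
      exact (φ.norm_coe_le_norm _).trans (le_mul_of_one_le_left (norm_nonneg _) h1)
    · rw [hg, ContinuousMap.evalCLM_apply, kernelFamily_apply hT]
  obtain ⟨Λ, -, h⟩ := kernelCone_le hP hgen hf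
  exact ⟨Λ, h⟩

theorem exists_contDiffOn_of_mem_kernelCone (hTc : IsCompact T) (hs : 0 < s)
    (hT : ∀ β ∈ T, 1 ≤ β.re) {f : C(disc, ℝ)} (hf : f ∈ kernelCone s T) :
    ∃ g : ℂ → ℝ, ContDiffOn ℝ ∞ g disc ∧ ∀ z : disc, g z = f z := by
  have : CompactSpace T := isCompact_iff_compactSpace.1 hTc
  obtain ⟨Λ, hΛ⟩ := exists_functional_of_mem_kernelCone hs hT hf
  exact ⟨fun z => Λ (kernelFamily s T z),
    fun z hz => (Λ.contDiff.contDiffAt.comp z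
      (contDiffAt_kernelFamily hT ⟨z, hz⟩)).contDiffWithinAt, fun z => (hΛ z).symm⟩

end Family

/-! ### Choice of the parameter set, and conjugation symmetry. -/

/-- A parameter set that contains `1` and is invariant under `β ↦ b + 1 / β` for `b ∈ B`;
it can be chosen compact if `B` is finite. -/
theorem exists_parameterSet {B : Set ℂ} (hB : B ⊆ indexSet) :
    ∃ T : Set ℂ, (∀ β ∈ T, 1 ≤ β.re) ∧ (1 : ℂ) ∈ T ∧ (∀ b ∈ B, ∀ β ∈ T, b + 1 / β ∈ T) ∧
      (B.Finite → IsCompact T) := by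
  by_cases hfin : B.Finite
  · obtain ⟨R, hR⟩ := hfin.isBounded.exists_norm_le
    -- The radius works because `|1 / β| ≤ 1`.
    refine ⟨{β | 1 ≤ β.re} ∩ Metric.closedBall 0 (|R| + 1), fun β h => h.1, ⟨by simp, by simp⟩,
      fun b hb β hβ => ⟨one_le_re_add_one_div (hB hb) hβ.1, ?_⟩, fun _ => ?_⟩
    · have h1 : 1 ≤ ‖β‖ := le_trans hβ.1 (Complex.re_le_norm _)
      rw [mem_closedBall_zero_iff]
      refine (norm_add_le _ _).trans (add_le_add ((hR b hb).trans (le_abs_self _)) ?_)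
      rw [norm_div, norm_one]
      exact (div_le_one (by linarith)).2 h1
    · exact (isCompact_closedBall _ _).inter_left
        (isClosed_le continuous_const Complex.continuous_re)
  · exact ⟨{β | 1 ≤ β.re}, fun β h => h, by simp,
      fun b hb β hβ => one_le_re_add_one_div (hB hb) hβ, fun h => absurd h hfin⟩

/-- Complex conjugation on the disc. -/
def discConj : C(disc, disc) where
  toFun z := ⟨(starRingEnd ℂ) z, by
    have := (mem_disc_iff z).1 z.2
    rw [mem_disc_iff]
    simpa using this⟩
  continuous_toFun := by fun_prop

/-- Conjugation carries `θ_b` to the map of the conjugate index, so the sum is merely reindexed. -/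
theorem transferOp_comp_discConj {B : Set ℂ} {hB : B ⊆ indexSet} {s : ℝ}
    {hs : criticalExponent B < s} (hBc : ∀ b ∈ B, (starRingEnd ℂ) b ∈ B) (f : C(disc, ℝ)) :
    transferOp B hB s hs (f.comp discConj) = (transferOp B hB s hs f).comp discConj := by
  let e : B ≃ B :=
    { toFun := fun b => ⟨_, hBc b b.2⟩
      invFun := fun b => ⟨_, hBc b b.2⟩
      left_inv := fun b => Subtype.ext (Complex.conj_conj _)
      right_inv := fun b => Subtype.ext (Complex.conj_conj _) }
  ext z
  rw [ContinuousMap.comp_apply, transferOp_apply, transferOp_apply, ← e.tsum_eq]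
  refine tsum_congr fun b => ?_
  have h1 : ((discConj z : disc) : ℂ) + (b : ℂ) = (starRingEnd ℂ) ((z : ℂ) + (e b : ℂ)) := by
    simp [discConj, e]
  rw [h1, RCLike.norm_conj, ContinuousMap.comp_apply]
  congr 2
  refine Subtype.ext ?_
  change (starRingEnd ℂ) (1 / ((z : ℂ) + (e b : ℂ))) = 1 / ((discConj z : disc) + (b : ℂ))
  rw [h1, map_div₀, map_one]

end ComplexCF

end

open ComplexCF
theorem mainTheorem3 (B : Set ℂ) (hB : B ⊆ indexSet) (hne : B.Nonempty) (s : ℝ)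
    (hs : criticalExponent B < s) :
    ∃ (v : C(disc, ℝ)) (r : ℝ),
      (∀ z, 0 < v z) ∧ (∃ K : NNReal, LipschitzWith K v) ∧
      0 < r ∧ transferOp B hB s hs v = r • v ∧
      Tendsto (fun k : ℕ => ‖transferOp B hB s hs ^ k‖ ^ (1 / (k : ℝ))) atTop (𝓝 r) ∧
      (∀ (w : C(disc, ℝ)) (μ : ℝ), (∀ z, 0 < w z) → transferOp B hB s hs w = μ • w →
        ∃ c : ℝ, w = c • v) ∧
      ((∀ b ∈ B, (starRingEnd ℂ) b ∈ B) →
        ∀ z w : disc, (w : ℂ) = (starRingEnd ℂ) (z : ℂ) → v w = v z) ∧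
      (B.Finite →
        (∃ g : ℂ → ℝ, ContDiffOn ℝ ∞ g disc ∧ ∀ z : disc, g z = v z) ∧
        ∀ z w : disc, (z : ℂ).im = (w : ℂ).im → (z : ℂ).re < (w : ℂ).re → v w < v z) := by
  have hs0 : 0 < s := (criticalExponent_nonneg B).trans_lt hs
  obtain ⟨T, hTre, hT1, hT, hTc⟩ := exists_parameterSet hB
  obtain ⟨v, hvT, r, hr, hv0, hv⟩ := exists_eigenfunction (hB := hB) (hs := hs) hne hT hT1
  refine ⟨v, r, hv0, ⟨_, lipschitzWith_of_mem_kernelCone hs0 hvT (M := ‖v‖₊) le_rfl⟩, hr, hv,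
    tendsto_norm_pow_rpow hr hv0 hv, fun w μ hw0 hw => eigenfunction_unique hne hv0 hw0 hv hw,
    fun hBc z w hzw => ?_, fun hfin => ⟨?_, fun z w him hre => ?_⟩⟩
  -- The reflected function is also a positive eigenfunction, hence `c v`; the fixed point `0` of
  -- conjugation gives `c = 1`.
  · obtain ⟨c, hc⟩ := eigenfunction_unique (hB := hB) (hs := hs) (w := v.comp discConj) (μ := r)
      hne hv0 (fun z => hv0 _) hv (by rw [transferOp_comp_discConj hBc, hv]; rfl)
    have hw : discConj z = w := Subtype.ext hzw.symm
    have hz0 : discConj ⟨0, zero_mem_disc⟩ = ⟨0, zero_mem_disc⟩ := Subtype.ext (map_zero _)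
    have h0 := congrArg (fun f : C(disc, ℝ) => f ⟨0, zero_mem_disc⟩) hc
    simp only [ContinuousMap.comp_apply, hz0, ContinuousMap.smul_apply, smul_eq_mul] at h0
    have hc1 : c = 1 := mul_right_cancel₀ (hv0 ⟨0, zero_mem_disc⟩).ne' (by linarith)
    have h1 := congrArg (fun f : C(disc, ℝ) => f z) hc
    simpa [hc1, hw] using h1
  · exact exists_contDiffOn_of_mem_kernelCone (hTc hfin) hs0 hTre hvT
  · obtain ⟨R, hR⟩ := (hTc hfin).isBounded.exists_norm_le
    obtain ⟨q, hq, h⟩ := strictAnti_of_mem_kernelCone hs0 hR him hre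
    have := h v hvT
    nlinarith [hv0 z]
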